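/- Consider three SQG point vortices in the plane with non-zero real circulations $\Gamma_1,\Gamma_2,\Gamma_3$, positions $(x_i,y_i)$ and mutual distances $r_{ij}=\sqrt{(x_i-x_j)^2+(y_i-y_j)^2}$, moving according to $$\dot x_i=\frac1{2\pi}\sum_{j\ne i}\Gamma_j\frac{y_i-y_j}{r_{ij}^3},\qquad \dot y_i=-\frac1{2\pi}\sum_{j\ne i}\Gamma_j\frac{x_i-x_j}{r_{ij}^3},\qquad i=1,2,3,$$ and let $H=\frac1{2\pi}\sum_{i<j}\Gamma_i\Gamma_j/r_{ij}$ be the (conserved) Hamiltonian. A collapsing solution is a solution on a time interval $[0,T)$, $0<T<\infty$, with pairwise distinct vortex positions, such that all $r_{ij}(t)\to0$ as $t\to T^-$. It is self-similar if the ratios $r_{23}/r_{12}$ and $r_{31}/r_{12}$ are constant on $[0,T)$. (1) The model possesses collapsing solutions, in which the three vortices converge to a common point as $t\to T^-$. (2) In the symmetric case $\Gamma_1=\Gamma_3=1$, $\Gamma_2=-\Gamma$ with $\Gamma>0$, a collapsing solution is self-similar if and only if $H=0$; so for $H=0$ every collapse is self-similar, and for $H\neq0$ no collapse is self-similar. (3)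 In the symmetric case, both kinds of collapse occur: the equation $$\frac{1+\sqrt{(2-\Gamma)\Gamma}}{1-\Gamma}=\frac{1+\sqrt{1+4\Gamma^2}}{2\Gamma}$$ has exactly one solution $\Gamma_*$ in $(0,1/2)$, and for every $\Gamma$ with $\Gamma_*<\Gamma<1/2$ and every real number $h$ there is a collapsing solution with $H=h$, in which the three vortices converge to a common point as $t\to T^-$. -/

import Mathlib

open Filter Topology

namespace SQGVortex

noncomputable section

/-- The mutual distance `r_ij` of the vortices `i` and `j` in the configuration `z`;
the vortex positions `(x_i, y_i)` are written as the complex numbers `z i = x_i + y_i I`. -/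
def r (z : Fin 3 → ℂ) (i j : Fin 3) : ℝ :=
  Real.sqrt (((z i).re - (z j).re) ^ 2 + ((z i).im - (z j).im) ^ 2)

/-- The velocity of vortex `i` in the SQG point-vortex model with circulations `Γ`:
`x_i' = (1 / 2π) ∑_{j ≠ i} Γ_j (y_i - y_j) / r_ij ^ 3` and
`y_i' = -(1 / 2π) ∑_{j ≠ i} Γ_j (x_i - x_j) / r_ij ^ 3`. -/
def velocity (Γ : Fin 3 → ℝ) (z : Fin 3 → ℂ) (i : Fin 3) : ℂ where
  re := 1 / (2 * Real.pi) * ∑ j ∈ Finset.univ.erase i, Γ j * ((z i).im - (z j).im) / r z i j ^ 3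
  im := -(1 / (2 * Real.pi)) *
    ∑ j ∈ Finset.univ.erase i, Γ j * ((z i).re - (z j).re) / r z i j ^ 3

/-- The Hamiltonian `H = (1 / 2π) ∑_{i < j} Γ_i Γ_j / r_ij`. -/
def hamiltonian (Γ : Fin 3 → ℝ) (z : Fin 3 → ℂ) : ℝ :=
  1 / (2 * Real.pi) * ∑ i, ∑ j ∈ Finset.Ioi i, Γ i * Γ j / r z i j

/-- `z` solves the equations of motion on `[0, T)`, the vortices being at pairwise distinct
positions there. -/
structure IsSolution (Γ : Fin 3 → ℝ) (T : ℝ) (z : ℝ → Fin 3 → ℂ) : Prop where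
  distinct : ∀ t ∈ Set.Ico 0 T, Function.Injective (z t)
  motion : ∀ t ∈ Set.Ico 0 T, ∀ i,
    HasDerivWithinAt (fun s => z s i) (velocity Γ (z t) i) (Set.Ico 0 T) t

/-- `z` is a solution that collapses at the finite time `T`: all mutual distances tend to zero. -/
structure IsCollapse (Γ : Fin 3 → ℝ) (T : ℝ) (z : ℝ → Fin 3 → ℂ) : Prop where
  pos : 0 < T
  solution : IsSolution Γ T z
  collapse : ∀ i j, Tendsto (fun t => r (z t) i j) (𝓝[<] T) (𝓝 0)

/-- The motion is self-similar on `[0, T)`: `r_23 / r_12` and `r_31 / r_12` are positive constants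
(vortices `1, 2, 3` have the indices `0, 1, 2`). -/
def IsSelfSimilar (T : ℝ) (z : ℝ → Fin 3 → ℂ) : Prop :=
  ∃ k₁ k₂ : ℝ, 0 < k₁ ∧ 0 < k₂ ∧ ∀ t ∈ Set.Ico 0 T,
    r (z t) 1 2 / r (z t) 0 1 = k₁ ∧ r (z t) 2 0 / r (z t) 0 1 = k₂

/-- The circulations of the symmetric case: `Γ₁ = Γ₃ = 1`, `Γ₂ = -G`. -/
def symmetricCirculation (G : ℝ) : Fin 3 → ℝ := ![1, -G, 1]

/-- `G` is the lower end of the permitted interval of circulations: on the boundary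
`r_31 = r_23 - r_12` of the triangle inequalities, the conditions `H = 0` and `M = 0` of the
symmetric case give the same line `r_23 = const * r_12`. -/
def IsCritical (G : ℝ) : Prop :=
  0 < G ∧ G < 1 / 2 ∧
    (1 + Real.sqrt ((2 - G) * G)) / (1 - G) = (1 + Real.sqrt (1 + 4 * G ^ 2)) / (2 * G)

end

end SQGVortex

/-!
Three vortices with circulations `1, -G, 1` conserve the Hamiltonian `H` and the angular moment
`M = r_31 ^ 2 - G (r_12 ^ 2 + r_23 ^ 2)`; the latter vanishes if the vortices collapse.

Since `H` is homogeneous of degree `-1` in the distances, a self-similar collapse forces `H = 0`.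
Conversely, if `H = M = 0`, then eliminating `r_31` leaves a nontrivial polynomial equation for
`r_23 / r_12`; a continuous function with values in its finite set of roots is constant
(`IsCollapse.isSelfSimilar_of_hamiltonian_eq_zero`).

For the existence of collapse, the conditions `M = 0` and `2 π H = κ` are solved for the shape
`(α, β, 1)` of the triangle with sides `r_12 = α c`, `r_23 = β c`, `r_31 = c`, as explicit functions of
the size `c`, regular up to `c = 0` for every `κ` (`exists_isShapeCurve`). The limiting shape at
`c = 0` is that of the self-similar collapse; it is a nondegenerate triangle exactly when
`(1 - G) ^ 2 < 4 G ^ 3 (2 - G)`, that is, when `G` exceeds the critical value. Along this curve the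
motion reduces to `c ^ 2 c' = -Φ c` with `Φ` continuous, and positive if the vortices are suitably
oriented, up to and including `c = 0`; hence `c` reaches `0` in finite time
(`exists_finite_time_shrinking`). A further quadrature gives the direction of `z 2 - z 0`, and the
positions are recovered by keeping the centre of vorticity at the origin. That the result solves the
equations of motion rests on the shape moving along the circle `M = 0` at the rate prescribed by the
conservation of `H` (`IsShapeCurve.shape_field`, `IsShapeCurve.hasDerivAt_shapePoint`).
-/

namespace SQGVortex

/-! ### The critical circulation -/

/-- Either side `s` of the defining equation is a number with `s + 1 / s = 2 / (1 - G)` and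
`s - 1 / s = 1 / G`; the quartic relation results from eliminating `s`. -/
theorem IsCritical.quartic {G : ℝ} (h : IsCritical G) : 4 * G ^ 3 * (2 - G) = (1 - G) ^ 2 := by
  obtain ⟨h0, h1, h⟩ := h
  have e1 : Real.sqrt ((2 - G) * G) ^ 2 = (2 - G) * G := Real.sq_sqrt (by nlinarith)
  have e2 : Real.sqrt (1 + 4 * G ^ 2) ^ 2 = 1 + 4 * G ^ 2 := Real.sq_sqrt (by positivity)
  set s := (1 + Real.sqrt ((2 - G) * G)) / (1 - G) with hs
  have hG : 1 - G ≠ 0 := by linarith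
  have hG' : G ≠ 0 := h0.ne'
  have r1 : Real.sqrt ((2 - G) * G) = s * (1 - G) - 1 := by rw [hs]; field_simp; ring
  have r2 : Real.sqrt (1 + 4 * G ^ 2) = s * (2 * G) - 1 := by rw [h]; field_simp; ring
  rw [r1] at e1
  rw [r2] at e2
  have q1 : (1 - G) * (s ^ 2 + 1) = 2 * s := mul_left_cancel₀ hG (by linear_combination e1)
  have q2 : G * (s ^ 2 - 1) = s := mul_left_cancel₀ hG' (by linear_combination e2 / 4)
  have hs0 : s ≠ 0 := by
    rintro h0
    rw [h0] at q1
    apply hG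
    linear_combination q1
  have : s ^ 2 * (4 * G ^ 3 * (2 - G)) = s ^ 2 * (1 - G) ^ 2 := by
    linear_combination (-G ^ 2 * ((1 - G) * (s ^ 2 + 1) + 2 * s)) * q1 +
      (1 - G) ^ 2 * (G * (s ^ 2 - 1) + s) * q2
  exact mul_left_cancel₀ (pow_ne_zero 2 hs0) this

theorem isCritical_of_quartic {G : ℝ} (h0 : 0 < G) (h1 : G < 1 / 2)
    (h : 4 * G ^ 3 * (2 - G) = (1 - G) ^ 2) : IsCritical G := by
  refine ⟨h0, h1, ?_⟩
  have hG : 0 < 1 - G := by linarith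
  have e1 : Real.sqrt ((2 - G) * G) ^ 2 = (2 - G) * G := Real.sq_sqrt (by nlinarith)
  have p1 := Real.sqrt_nonneg ((2 - G) * G)
  set q := Real.sqrt ((2 - G) * G)
  have e2 : Real.sqrt (1 + 4 * G ^ 2) = (1 + q) * (2 * G) / (1 - G) - 1 := by
    -- by the quartic equation, `(2 G q) ^ 2 = (1 - G) ^ 2`
    have hq : 2 * G * q = 1 - G := by
      refine (sq_eq_sq₀ (by positivity) hG.le).1 ?_
      linear_combination 4 * G ^ 2 * e1 + h
    have : (1 + q) * (2 * G) / (1 - G) - 1 = 2 * G / (1 - G) := by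
      field_simp
      linear_combination hq
    rw [this, Real.sqrt_eq_iff_mul_self_eq (by positivity) (by positivity)]
    field_simp
    linear_combination -h
  rw [e2]
  field_simp
  ring

/-- `4 G ^ 3 (2 - G)` increases and `(1 - G) ^ 2` decreases on `(0, 1)`. -/
theorem quartic_lt_of_lt {a b : ℝ} (ha : 0 < a) (hab : a < b) (hb : b < 1)
    (h : (1 - a) ^ 2 ≤ 4 * a ^ 3 * (2 - a)) : (1 - b) ^ 2 < 4 * b ^ 3 * (2 - b) := by
  have h1 : (1 - b) ^ 2 < (1 - a) ^ 2 := by nlinarith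
  have h2 : a ^ 2 ≤ b ^ 2 := by gcongr
  have h3 : a * (2 - a) ≤ b * (2 - b) := by nlinarith
  have h4 : a ^ 2 * (a * (2 - a)) ≤ b ^ 2 * (b * (2 - b)) :=
    mul_le_mul h2 h3 (by nlinarith) (by positivity)
  nlinarith

theorem existsUnique_isCritical : ∃! G : ℝ, IsCritical G := by
  have hc : ContinuousOn (fun G : ℝ => 4 * G ^ 3 * (2 - G) - (1 - G) ^ 2) (Set.Icc 0 (1 / 2)) := by
    fun_prop
  obtain ⟨G, ⟨h0, h1⟩, hG⟩ := intermediate_value_Ioo (by norm_num) hc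
    (show (0 : ℝ) ∈ Set.Ioo _ _ by constructor <;> norm_num)
  refine ⟨G, isCritical_of_quartic h0 h1 (sub_eq_zero.1 hG), fun G' h' => ?_⟩
  have e := h'.quartic
  have e' := sub_eq_zero.1 hG
  rcases lt_trichotomy G' G with hl | hl | hl
  · exact absurd e' (quartic_lt_of_lt h'.1 hl (by linarith) e.ge).ne'
  · exact hl
  · exact absurd e (quartic_lt_of_lt h0 hl (by linarith [h'.2.1]) e'.ge).ne'

/-! ### Equations of motion, conserved quantities and self-similarity -/

theorem r_eq_norm (z : Fin 3 → ℂ) (i j : Fin 3) : r z i j = ‖z i - z j‖ := by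
  rw [Complex.norm_eq_sqrt_sq_add_sq]
  rfl

theorem r_symm (z : Fin 3 → ℂ) (i j : Fin 3) : r z i j = r z j i := by
  rw [r_eq_norm, r_eq_norm, norm_sub_rev]

/-- The equations of motion in complex form: `z_i' = -(i / 2π) ∑_{j ≠ i} Γ_j (z_i - z_j) / r_ij ^ 3`. -/
theorem velocity_eq_sum (Γ : Fin 3 → ℝ) (z : Fin 3 → ℂ) (i : Fin 3) :
    velocity Γ z i = -(Complex.I / (2 * Real.pi)) *
      ∑ j ∈ Finset.univ.erase i, (Γ j / r z i j ^ 3 : ℝ) * (z i - z j) := by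
  have hc : -(Complex.I / (2 * Real.pi)) = ((-(1 / (2 * Real.pi)) : ℝ) : ℂ) * Complex.I := by
    push_cast
    ring
  rw [hc]
  apply Complex.ext
  · simp only [velocity, mul_assoc, Complex.re_ofReal_mul, Complex.I_mul_re, Complex.im_sum,
      Complex.im_ofReal_mul, Complex.sub_im, neg_mul_neg]
    congr 1
    exact Finset.sum_congr rfl fun j _ => by ring
  · simp only [velocity, mul_assoc, Complex.im_ofReal_mul, Complex.I_mul_im, Complex.re_sum,
      Complex.re_ofReal_mul, Complex.sub_re]
    congr 1
    exact Finset.sum_congr rfl fun j _ => by ring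

theorem hamiltonian_symmetricCirculation (G : ℝ) (z : Fin 3 → ℂ) :
    hamiltonian (symmetricCirculation G) z =
      1 / (2 * Real.pi) * (1 / r z 0 2 - G / r z 0 1 - G / r z 1 2) := by
  have h0 : Finset.Ioi (0 : Fin 3) = {1, 2} := by decide
  have h1 : Finset.Ioi (1 : Fin 3) = {2} := by decide
  have h2 : Finset.Ioi (2 : Fin 3) = ∅ := by decide
  simp [hamiltonian, Fin.sum_univ_three, h0, h1, h2, symmetricCirculation]
  ring

theorem sum_erase_zero {M : Type*} [AddCommMonoid M] (f : Fin 3 → M) :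
    ∑ j ∈ Finset.univ.erase 0, f j = f 1 + f 2 := by
  rw [show Finset.univ.erase (0 : Fin 3) = {1, 2} by decide, Finset.sum_pair (by decide)]

theorem sum_erase_one {M : Type*} [AddCommMonoid M] (f : Fin 3 → M) :
    ∑ j ∈ Finset.univ.erase 1, f j = f 0 + f 2 := by
  rw [show Finset.univ.erase (1 : Fin 3) = {0, 2} by decide, Finset.sum_pair (by decide)]

theorem sum_erase_two {M : Type*} [AddCommMonoid M] (f : Fin 3 → M) :
    ∑ j ∈ Finset.univ.erase 2, f j = f 0 + f 1 := by
  rw [show Finset.univ.erase (2 : Fin 3) = {0, 1} by decide, Finset.sum_pair (by decide)]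

/-- For the circulations `1, -G, 1` this is `∑_{i < j} Γ_i Γ_j r_ij ^ 2`, which together with the
Hamiltonian is the invariant of the motion that depends on the mutual distances only. -/
noncomputable def angularMoment (G : ℝ) (z : Fin 3 → ℂ) : ℝ :=
  r z 0 2 ^ 2 - G * (r z 0 1 ^ 2 + r z 1 2 ^ 2)

theorem r_sq (z : Fin 3 → ℂ) (i j : Fin 3) :
    r z i j ^ 2 = ((z i).re - (z j).re) ^ 2 + ((z i).im - (z j).im) ^ 2 :=
  Real.sq_sqrt (by positivity)

section Conservation

variable {Γ : Fin 3 → ℝ} {G T : ℝ} {z : ℝ → Fin 3 → ℂ}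

theorem IsSolution.r_pos (hz : IsSolution Γ T z) {t : ℝ} (ht : t ∈ Set.Ico 0 T)
    {i j : Fin 3} (hij : i ≠ j) : 0 < r (z t) i j := by
  rw [r_eq_norm, norm_pos_iff, sub_ne_zero]
  exact (hz.distinct t ht).ne hij

theorem IsSolution.hasDerivWithinAt_r_sq (hz : IsSolution Γ T z) {t : ℝ} (ht : t ∈ Set.Ico 0 T)
    (i j : Fin 3) :
    HasDerivWithinAt (fun s => r (z s) i j ^ 2)
      (2 * (((z t i).re - (z t j).re) * ((velocity Γ (z t) i).re - (velocity Γ (z t) j).re) +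
        ((z t i).im - (z t j).im) * ((velocity Γ (z t) i).im - (velocity Γ (z t) j).im)))
      (Set.Ico 0 T) t := by
  have hre : ∀ k, HasDerivWithinAt (fun s => (z s k).re) (velocity Γ (z t) k).re
      (Set.Ico 0 T) t := fun k =>
    (Complex.reCLM.hasFDerivAt (x := z t k)).comp_hasDerivWithinAt t
      (f := fun s => z s k) (hz.motion t ht k)
  have him : ∀ k, HasDerivWithinAt (fun s => (z s k).im) (velocity Γ (z t) k).im
      (Set.Ico 0 T) t := fun k =>
    (Complex.imCLM.hasFDerivAt (x := z t k)).comp_hasDerivWithinAt t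
      (f := fun s => z s k) (hz.motion t ht k)
  simp only [r_sq]
  refine ((((hre i).sub (hre j)).pow 2).add (((him i).sub (him j)).pow 2)).congr_deriv ?_
  simp only [Pi.sub_apply]
  ring

theorem IsSolution.hasDerivWithinAt_inv_r (hz : IsSolution Γ T z) {t : ℝ} (ht : t ∈ Set.Ico 0 T)
    {i j : Fin 3} (hij : i ≠ j) :
    HasDerivWithinAt (fun s => 1 / r (z s) i j)
      (-(((z t i).re - (z t j).re) * ((velocity Γ (z t) i).re - (velocity Γ (z t) j).re) +
        ((z t i).im - (z t j).im) * ((velocity Γ (z t) i).im - (velocity Γ (z t) j).im)) /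
          r (z t) i j ^ 3)
      (Set.Ico 0 T) t := by
  have hr := hz.r_pos ht hij
  have h := ((hz.hasDerivWithinAt_r_sq ht i j).sqrt (by positivity)).inv
    (Real.sqrt_ne_zero'.2 (by positivity))
  have hs : ∀ s, Real.sqrt (r (z s) i j ^ 2) = r (z s) i j := fun s =>
    Real.sqrt_sq (Real.sqrt_nonneg _)
  simp only [hs] at h
  simp only [one_div]
  refine h.congr_deriv ?_
  field_simp

theorem eq_of_hasDerivWithinAt_zero {f : ℝ → ℝ}
    (hf : ∀ t ∈ Set.Ico 0 T, HasDerivWithinAt f 0 (Set.Ico 0 T) t) {t : ℝ}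
    (ht : t ∈ Set.Ico 0 T) : f t = f 0 := by
  have := (convex_Ico 0 T).norm_image_sub_le_of_norm_hasDerivWithin_le (C := 0) hf
    (fun x _ => by simp) ⟨le_rfl, ht.1.trans_lt ht.2⟩ ht
  rwa [zero_mul, norm_le_zero_iff, sub_eq_zero] at this

theorem IsSolution.angularMoment_eq (hz : IsSolution (symmetricCirculation G) T z) {t : ℝ}
    (ht : t ∈ Set.Ico 0 T) : angularMoment G (z t) = angularMoment G (z 0) := by
  refine eq_of_hasDerivWithinAt_zero (f := fun t => angularMoment G (z t)) (fun t ht => ?_) ht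
  refine ((hz.hasDerivWithinAt_r_sq ht 0 2).sub (((hz.hasDerivWithinAt_r_sq ht 0 1).add
    (hz.hasDerivWithinAt_r_sq ht 1 2)).const_mul G)).congr_deriv ?_
  simp only [velocity, sum_erase_zero, sum_erase_one, sum_erase_two, symmetricCirculation,
    r_symm (z t) 1 0, r_symm (z t) 2 0, r_symm (z t) 2 1, div_eq_mul_inv]
  simp
  ring

theorem IsSolution.hamiltonian_eq (hz : IsSolution (symmetricCirculation G) T z) {t : ℝ}
    (ht : t ∈ Set.Ico 0 T) : hamiltonian (symmetricCirculation G) (z t) =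
      hamiltonian (symmetricCirculation G) (z 0) := by
  refine eq_of_hasDerivWithinAt_zero (f := fun t => hamiltonian (symmetricCirculation G) (z t))
    (fun t ht => ?_) ht
  have h01 := hz.hasDerivWithinAt_inv_r ht (show (0 : Fin 3) ≠ 1 by decide)
  have h12 := hz.hasDerivWithinAt_inv_r ht (show (1 : Fin 3) ≠ 2 by decide)
  have h02 := hz.hasDerivWithinAt_inv_r ht (show (0 : Fin 3) ≠ 2 by decide)
  simp only [hamiltonian_symmetricCirculation, div_eq_mul_one_div G]
  refine (((h02.sub (h01.const_mul G)).sub (h12.const_mul G)).const_mul _).congr_deriv ?_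
  simp only [velocity, sum_erase_zero, sum_erase_one, sum_erase_two, symmetricCirculation,
    r_symm (z t) 1 0, r_symm (z t) 2 0, r_symm (z t) 2 1, div_eq_mul_inv]
  simp
  ring

end Conservation

section SelfSimilar

variable {G T : ℝ} {z : ℝ → Fin 3 → ℂ}

theorem IsCollapse.angularMoment_eq_zero (hz : IsCollapse (symmetricCirculation G) T z) {t : ℝ}
    (ht : t ∈ Set.Ico 0 T) : angularMoment G (z t) = 0 := by
  have hlim : Tendsto (fun t => angularMoment G (z t)) (𝓝[<] T) (𝓝 0) := by
    have := ((hz.collapse 0 2).pow 2).sub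
      ((((hz.collapse 0 1).pow 2).add ((hz.collapse 1 2).pow 2)).const_mul G)
    simpa [angularMoment] using this
  have hev : (fun t => angularMoment G (z t)) =ᶠ[𝓝[<] T] fun _ => angularMoment G (z 0) := by
    filter_upwards [Ico_mem_nhdsLT hz.pos] with s hs using hz.solution.angularMoment_eq hs
  rw [hz.solution.angularMoment_eq ht]
  exact tendsto_nhds_unique (tendsto_const_nhds.congr' hev.symm) hlim

theorem IsCollapse.hamiltonian_eq_zero_of_isSelfSimilar
    (hz : IsCollapse (symmetricCirculation G) T z) (h : IsSelfSimilar T z) :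
    hamiltonian (symmetricCirculation G) (z 0) = 0 := by
  obtain ⟨k₁, k₂, h₁, h₂, h⟩ := h
  set H := hamiltonian (symmetricCirculation G) (z 0) with hH
  -- by homogeneity, `H` is a constant multiple of `1 / r_12`
  have key : ∀ t ∈ Set.Ico 0 T, H * r (z t) 0 1 = 1 / (2 * Real.pi) * (1 / k₂ - G - G / k₁) := by
    intro t ht
    have hr := hz.solution.r_pos ht (show (0 : Fin 3) ≠ 1 by decide)
    obtain ⟨e₁, e₂⟩ := h t ht
    rw [div_eq_iff hr.ne'] at e₁ e₂
    rw [hH, ← hz.solution.hamiltonian_eq ht, hamiltonian_symmetricCirculation, r_symm _ 0 2, e₁, e₂]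
    field_simp
  have hlim : Tendsto (fun t => H * r (z t) 0 1) (𝓝[<] T) (𝓝 0) := by
    simpa using (hz.collapse 0 1).const_mul H
  have hev : (fun t => H * r (z t) 0 1) =ᶠ[𝓝[<] T]
      fun _ => 1 / (2 * Real.pi) * (1 / k₂ - G - G / k₁) := by
    filter_upwards [Ico_mem_nhdsLT hz.pos] with s hs using key s hs
  have h0 := tendsto_nhds_unique (tendsto_const_nhds.congr' hev.symm) hlim
  have hT : (0 : ℝ) ∈ Set.Ico 0 T := ⟨le_rfl, hz.pos⟩
  have := key 0 hT
  rw [h0] at this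
  exact (mul_eq_zero.1 this).resolve_right
    (hz.solution.r_pos hT (show (0 : Fin 3) ≠ 1 by decide)).ne'

/-- The equation for `s = r_23 / r_12` that results from eliminating `r_31` from `H = 0` and `M = 0`. -/
theorem finite_setOf_shape_equation (hG : 0 < G) :
    {s : ℝ | G ^ 3 * (1 + s) ^ 2 * (1 + s ^ 2) = s ^ 2}.Finite := by
  open Polynomial in
  have hp : (C (G ^ 3) * (1 + X) ^ 2 * (1 + X ^ 2) - X ^ 2 : ℝ[X]) ≠ 0 := by
    intro h
    have := congrArg (Polynomial.eval 0) h
    simp [hG.ne'] at this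
  refine (Polynomial.finite_setOfPred_isRoot hp).subset fun s hs => ?_
  simpa [Polynomial.IsRoot, sub_eq_zero] using hs

theorem IsCollapse.isSelfSimilar_of_hamiltonian_eq_zero (hG : 0 < G)
    (hz : IsCollapse (symmetricCirculation G) T z)
    (h : hamiltonian (symmetricCirculation G) (z 0) = 0) : IsSelfSimilar T z := by
  have p01 : ∀ t ∈ Set.Ico 0 T, 0 < r (z t) 0 1 := fun t ht =>
    hz.solution.r_pos ht (by decide)
  have p12 : ∀ t ∈ Set.Ico 0 T, 0 < r (z t) 1 2 := fun t ht =>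
    hz.solution.r_pos ht (by decide)
  have p02 : ∀ t ∈ Set.Ico 0 T, 0 < r (z t) 0 2 := fun t ht =>
    hz.solution.r_pos ht (by decide)
  have hH : ∀ t ∈ Set.Ico 0 T,
      G * r (z t) 0 2 * (r (z t) 0 1 + r (z t) 1 2) = r (z t) 0 1 * r (z t) 1 2 := by
    intro t ht
    have e := hz.solution.hamiltonian_eq ht
    rw [h, hamiltonian_symmetricCirculation, mul_eq_zero] at e
    have e := e.resolve_left (by positivity)
    have := p01 t ht
    have := p12 t ht
    have := p02 t ht
    field_simp at e
    linear_combination -e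
  have hM : ∀ t ∈ Set.Ico 0 T, r (z t) 0 2 ^ 2 = G * (r (z t) 0 1 ^ 2 + r (z t) 1 2 ^ 2) :=
    fun t ht => sub_eq_zero.1 (hz.angularMoment_eq_zero ht)
  have hroot : ∀ t ∈ Set.Ico 0 T, r (z t) 1 2 / r (z t) 0 1 ∈
      {s : ℝ | G ^ 3 * (1 + s) ^ 2 * (1 + s ^ 2) = s ^ 2} := by
    intro t ht
    have := p01 t ht
    have e1 := hH t ht
    have e2 := hM t ht
    simp only [Set.mem_ofPred_eq]
    field_simp
    linear_combination (G * r (z t) 0 2 * (r (z t) 0 1 + r (z t) 1 2) +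
      r (z t) 0 1 * r (z t) 1 2) * e1 - G ^ 2 * (r (z t) 0 1 + r (z t) 1 2) ^ 2 * e2
  have hrc : ∀ i j, ContinuousOn (fun t => r (z t) i j) (Set.Ico 0 T) := by
    intro i j
    simp only [r_eq_norm]
    exact (ContinuousOn.sub (fun t ht => (hz.solution.motion t ht i).continuousWithinAt)
      fun t ht => (hz.solution.motion t ht j).continuousWithinAt).norm
  have hsub : ((fun t => r (z t) 1 2 / r (z t) 0 1) '' Set.Ico 0 T).Subsingleton :=
    (finite_setOf_shape_equation hG).countable.isTotallyDisconnected _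
      (Set.image_subset_iff.2 hroot)
      (isPreconnected_Ico.image _ ((hrc 1 2).div (hrc 0 1) fun t ht => (p01 t ht).ne'))
  have hT : (0 : ℝ) ∈ Set.Ico 0 T := ⟨le_rfl, hz.pos⟩
  set s := r (z 0) 1 2 / r (z 0) 0 1 with hs
  have hs0 : 0 < s := div_pos (p12 0 hT) (p01 0 hT)
  refine ⟨s, s / (G * (1 + s)), hs0, by positivity, fun t ht => ?_⟩
  have e : r (z t) 1 2 / r (z t) 0 1 = s :=
    hsub (Set.mem_image_of_mem _ ht) (Set.mem_image_of_mem _ hT)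
  refine ⟨e, ?_⟩
  have e1 := hH t ht
  have := p01 t ht
  have e' := e
  rw [div_eq_iff (p01 t ht).ne'] at e'
  rw [e'] at e1
  rw [r_symm, div_eq_div_iff this.ne' (by positivity)]
  exact mul_left_cancel₀ this.ne' (by linear_combination e1)

end SelfSimilar

/-! ### The scalar equation for the size -/

/-- A scalar autonomous equation `v' = -g v` with `g` continuous, positive and bounded is solved by
inverting the travel time `∫ 1 / g`; no Lipschitz condition on `g` is needed. -/
theorem exists_hasDerivAt_neg_reaching_zero {g : ℝ → ℝ} (hg : Continuous g) (hpos : ∀ x, 0 < g x)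
    {B : ℝ} (hB : ∀ x, g x ≤ B) {v₀ : ℝ} (hv₀ : 0 < v₀) :
    ∃ (T : ℝ) (v : ℝ → ℝ), 0 < T ∧ v 0 = v₀ ∧ v T = 0 ∧ ∀ t, HasDerivAt v (-g (v t)) t := by
  have hB0 : 0 < B := (hpos 0).trans_le (hB 0)
  have hg' : Continuous fun x => (g x)⁻¹ := hg.inv₀ fun x => (hpos x).ne'
  set Θ : ℝ → ℝ := fun x => ∫ y in (0 : ℝ)..x, (g y)⁻¹ with hΘ
  have hd : ∀ x, HasDerivAt Θ (g x)⁻¹ x := fun x => hg'.integral_hasStrictDerivAt 0 x |>.hasDerivAt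
  have h0 : Θ 0 = 0 := by simp [hΘ]
  have hmono : StrictMono Θ := strictMono_of_deriv_pos fun x => by
    rw [(hd x).deriv]
    exact inv_pos.2 (hpos x)
  -- the travel time grows at least linearly, hence is onto
  have hlin : Monotone fun x => Θ x - B⁻¹ * x := by
    have hd' : ∀ x, HasDerivAt (fun x => Θ x - B⁻¹ * x) ((g x)⁻¹ - B⁻¹ * 1) x := fun x =>
      (hd x).sub ((hasDerivAt_id x).const_mul _)
    refine monotone_of_deriv_nonneg (fun x => (hd' x).differentiableAt) fun x => ?_
    rw [(hd' x).deriv, mul_one, sub_nonneg]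
    exact inv_anti₀ (hpos x) (hB x)
  have hsurj : Function.Surjective Θ := by
    have hcont : Continuous Θ := continuous_iff_continuousAt.2 fun x => (hd x).continuousAt
    refine hcont.surjective ?_ ?_
    · refine tendsto_atTop_mono' _ ?_ (tendsto_id.const_mul_atTop (inv_pos.2 hB0))
      filter_upwards [eventually_ge_atTop 0] with x hx
      have := hlin hx
      simp only [h0, mul_zero, sub_zero] at this
      simpa using this
    · refine tendsto_atBot_mono' _ ?_ (tendsto_id.const_mul_atBot (inv_pos.2 hB0))
      filter_upwards [eventually_le_atBot 0] with x hx
      have := hlin hx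
      simp only [h0, mul_zero, sub_zero] at this
      simpa using this
  set e := hmono.orderIsoOfSurjective Θ hsurj
  have he : ∀ x, e x = Θ x := fun _ => rfl
  have hinv : ∀ y, HasDerivAt e.symm (g (e.symm y)) y := by
    intro y
    have := HasDerivAt.of_local_left_inverse (f := Θ) (g := e.symm) (a := y)
      (f' := (g (e.symm y))⁻¹) e.symm.continuous.continuousAt (hd _)
      (inv_ne_zero (hpos _).ne') (Eventually.of_forall fun x => e.apply_symm_apply x)
    rwa [inv_inv] at this
  refine ⟨Θ v₀, fun t => e.symm (Θ v₀ - t), ?_, ?_, ?_, fun t => ?_⟩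
  · rw [← h0]
    exact hmono hv₀
  · beta_reduce
    rw [sub_zero, ← he, e.symm_apply_apply]
  · beta_reduce
    rw [sub_self, e.symm_apply_eq, he, h0]
  · exact (HasDerivAt.comp_const_sub (f := e.symm) (Θ v₀) t (hinv _))

/-- The size equation `c ^ 2 c' = -Φ c` reaches `c = 0` in finite time when `Φ` is positive up to and
including `0`: in terms of `c ^ 3` it is regular. The solution is given on a neighbourhood of
`[0, T)`, so that two-sided derivatives are available at time `0`. -/
theorem exists_finite_time_shrinking {Φ : ℝ → ℝ} {c₁ : ℝ} (hc₁ : 0 < c₁)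
    (hΦ : ContinuousOn Φ (Set.Icc 0 c₁)) (hpos : ∀ c ∈ Set.Icc 0 c₁, 0 < Φ c) :
    ∃ (ε T : ℝ) (c : ℝ → ℝ), 0 < ε ∧ 0 < T ∧
      (∀ t ∈ Set.Ioo (-ε) T, c t ∈ Set.Ioo 0 c₁ ∧ HasDerivAt c (-Φ (c t) / c t ^ 2) t) ∧
      Tendsto c (𝓝[<] T) (𝓝 0) := by
  set Ψ : ℝ → ℝ := Set.IccExtend hc₁.le fun c => Φ c
  have hΨ : Continuous Ψ := (continuousOn_iff_continuous_domRestrict.1 hΦ).Icc_extend'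
  have hΨpos : ∀ c, 0 < Ψ c := fun c => hpos _ (Subtype.coe_prop _)
  obtain ⟨B, hB⟩ := (isCompact_Icc.image_of_continuousOn hΦ).bddAbove
  have hΨB : ∀ c, Ψ c ≤ B := fun c => hB ⟨_, Subtype.coe_prop _, rfl⟩
  have hroot : Continuous fun v : ℝ => v ^ (1 / 3 : ℝ) := Real.continuous_rpow_const (by norm_num)
  have hv₀ : 0 < (c₁ / 2) ^ 3 := by positivity
  obtain ⟨T, v, hT, hv0, hvT, hv⟩ := exists_hasDerivAt_neg_reaching_zero
    (g := fun v => 3 * Ψ (v ^ (1 / 3 : ℝ))) (by fun_prop)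
    (fun x => mul_pos three_pos (hΨpos _)) (B := 3 * B)
    (fun x => mul_le_mul_of_nonneg_left (hΨB _) zero_le_three) hv₀
  have hanti : StrictAnti v := strictAnti_of_deriv_neg fun t => by
    rw [(hv t).deriv]
    have := hΨpos (v t ^ (1 / 3 : ℝ))
    linarith
  have hvc : Continuous v := continuous_iff_continuousAt.2 fun t => (hv t).continuousAt
  have hlt : ∀ᶠ t in 𝓝 (0 : ℝ), v t < c₁ ^ 3 := by
    refine hvc.continuousAt.eventually_lt_const ?_
    rw [hv0]
    gcongr
    linarith
  obtain ⟨ε, hε, hball⟩ := Metric.eventually_nhds_iff.1 hlt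
  refine ⟨ε / 2, T, fun t => v t ^ (1 / 3 : ℝ), by positivity, hT, fun t ht => ?_, ?_⟩
  · have hvpos : 0 < v t := hvT ▸ hanti ht.2
    have hvlt : v t < c₁ ^ 3 := by
      refine (hanti ht.1).trans (hball ?_)
      rw [Real.dist_eq, sub_zero, abs_neg, abs_of_pos (by positivity)]
      linarith
    have hc : 0 < v t ^ (1 / 3 : ℝ) := by positivity
    have hcube : (v t ^ (1 / 3 : ℝ)) ^ 3 = v t := by
      rw [← Real.rpow_natCast, ← Real.rpow_mul hvpos.le]
      norm_num
    have hmem : v t ^ (1 / 3 : ℝ) ∈ Set.Ioo 0 c₁ :=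
      ⟨hc, lt_of_pow_lt_pow_left₀ 3 hc₁.le (by rwa [hcube])⟩
    refine ⟨hmem, ((hv t).rpow_const (p := 1 / 3) (Or.inl hvpos.ne')).congr_deriv ?_⟩
    have hΨeq : Ψ (v t ^ (1 / 3 : ℝ)) = Φ (v t ^ (1 / 3 : ℝ)) :=
      Set.IccExtend_of_mem _ _ ⟨hmem.1.le, hmem.2.le⟩
    rw [hΨeq, Real.rpow_sub_one hvpos.ne']
    have hdiv : v t ^ (1 / 3 : ℝ) / v t = 1 / (v t ^ (1 / 3 : ℝ)) ^ 2 := by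
      rw [div_eq_div_iff hvpos.ne' (by positivity), one_mul, ← pow_succ', hcube]
    rw [hdiv]
    field_simp
  · have : Tendsto (fun t => v t ^ (1 / 3 : ℝ)) (𝓝 T) (𝓝 (v T ^ (1 / 3 : ℝ))) :=
      (hroot.comp hvc).tendsto T
    rw [hvT, Real.zero_rpow (by norm_num)] at this
    exact this.mono_left nhdsWithin_le_nhds

theorem exists_antiderivative_Ioo {f : ℝ → ℝ} {a b : ℝ} (hf : ContinuousOn f (Set.Ioo a b)) :
    ∃ F : ℝ → ℝ, ∀ t ∈ Set.Ioo a b, HasDerivAt F (f t) t := by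
  by_cases hab : a < b
  · have hm : (a + b) / 2 ∈ Set.Ioo a b := ⟨by linarith, by linarith⟩
    refine ⟨fun t => ∫ s in (a + b) / 2..t, f s, fun t ht => ?_⟩
    exact intervalIntegral.integral_hasDerivAt_right
      ((hf.mono (Set.ordConnected_Ioo.uIcc_subset hm ht)).intervalIntegrable)
      (hf.stronglyMeasurableAtFilter isOpen_Ioo t ht) (hf.continuousAt (isOpen_Ioo.mem_nhds ht))
  · exact ⟨0, fun t ht => absurd (ht.1.trans ht.2) hab⟩

/-! ### Triangles with vanishing angular moment and prescribed energy -/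

/-- The curve of triangles `(α c, β c, 1)`, parametrised by a size `c ∈ [0, c₁]`, such that the
triangle with sides `r_12 = α c * c`, `r_23 = β c * c` and `r_31 = c` has vanishing angular moment
and Hamiltonian `κ / (2 π)`. The number `y c` is the height over the side of length `1`. -/
structure IsShapeCurve (G κ c₁ : ℝ) (α β y : ℝ → ℝ) : Prop where
  pos : ∀ c ∈ Set.Icc 0 c₁, 0 < α c
  lt : ∀ c ∈ Set.Icc 0 c₁, α c < β c
  height_pos : ∀ c ∈ Set.Icc 0 c₁, 0 < y c
  moment : ∀ c ∈ Set.Icc 0 c₁, α c ^ 2 + β c ^ 2 = 1 / G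
  energy : ∀ c ∈ Set.Icc 0 c₁, 1 - G / α c - G / β c = κ * c
  height : ∀ c ∈ Set.Icc 0 c₁, y c ^ 2 = α c ^ 2 - ((1 + α c ^ 2 - β c ^ 2) / 2) ^ 2
  diff_fst : ∀ c ∈ Set.Icc 0 c₁, DifferentiableAt ℝ α c
  diff_snd : ∀ c ∈ Set.Icc 0 c₁, DifferentiableAt ℝ β c
  diff_height : ∀ c ∈ Set.Icc 0 c₁, DifferentiableAt ℝ y c

/-- With `e = G / (1 - κ c)`, the two conditions on `α` and `β` say that `u = α + β` satisfies
`u ^ 2 = 2 e u + 1 / G` and that `α β = e u`. At `c = 0` the triangle is scalene because `G < 1 / 2`,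
and nondegenerate because of the quartic inequality; both persist for small `c`. -/
theorem exists_isShapeCurve {G : ℝ} (h0 : 0 < G) (h1 : G < 1 / 2)
    (h : (1 - G) ^ 2 < 4 * G ^ 3 * (2 - G)) (κ : ℝ) :
    ∃ (c₁ : ℝ) (α β y : ℝ → ℝ), 0 < c₁ ∧ IsShapeCurve G κ c₁ α β y := by
  set e : ℝ → ℝ := fun c => G / (1 - κ * c) with he
  set u : ℝ → ℝ := fun c => e c + Real.sqrt (e c ^ 2 + 1 / G) with hu
  set Δ : ℝ → ℝ := fun c => u c ^ 2 - 4 * e c * u c with hΔ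
  have hsq : ∀ c, u c ^ 2 = 2 * e c * u c + 1 / G := by
    intro c
    have : Real.sqrt (e c ^ 2 + 1 / G) ^ 2 = e c ^ 2 + 1 / G := Real.sq_sqrt (by positivity)
    simp only [hu]
    linear_combination this
  have hd : ∀ c, 0 < 1 - κ * c → DifferentiableAt ℝ e c := fun c hc => by
    have := hc.ne'
    fun_prop (disch := assumption)
  have hdu : ∀ c, 0 < 1 - κ * c → DifferentiableAt ℝ u c := fun c hc =>
    (hd c hc).add ((((hd c hc).pow 2).add_const _).sqrt
      (show 0 < e c ^ 2 + 1 / G by positivity).ne')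
  have hdΔ : ∀ c, 0 < 1 - κ * c → DifferentiableAt ℝ Δ c := fun c hc =>
    ((hdu c hc).pow 2).sub (((hd c hc).const_mul 4).mul (hdu c hc))
  have he0 : e 0 = G := by simp [he]
  have hΔ0 : Δ 0 = 1 / G - 2 * G * u 0 := by
    simp only [hΔ, hsq 0, he0]
    ring
  have hu0' : u 0 = G + Real.sqrt (G ^ 2 + 1 / G) := by simp only [hu, he0]
  have hscalene : 0 < Δ 0 := by
    have : Real.sqrt (G ^ 2 + 1 / G) < 1 / (2 * G ^ 2) - G := by
      have hG3 : G ^ 3 < 1 / 8 := by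
        calc G ^ 3 < (1 / 2) ^ 3 := by gcongr
          _ = 1 / 8 := by norm_num
      have e1 : 1 / (2 * G ^ 2) - G = (1 - 2 * G ^ 3) / (2 * G ^ 2) := by
        field_simp
      have hnn : 0 < 1 - 2 * G ^ 3 := by linarith
      rw [Real.sqrt_lt' (by rw [e1]; positivity)]
      rw [← sub_pos]
      have : (1 / (2 * G ^ 2) - G) ^ 2 - (G ^ 2 + 1 / G) = (1 - 8 * G ^ 3) / (4 * G ^ 4) := by
        field_simp
        ring
      rw [this]
      have : 0 < 1 - 8 * G ^ 3 := by linarith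
      positivity
    rw [hΔ0, hu0', sub_pos]
    calc 2 * G * (G + Real.sqrt (G ^ 2 + 1 / G)) < 2 * G * (G + (1 / (2 * G ^ 2) - G)) := by gcongr
      _ = 1 / G := by field_simp; ring
  have hnondeg : Δ 0 < 1 := by
    have : (1 - G) / (2 * G ^ 2) - G < Real.sqrt (G ^ 2 + 1 / G) := by
      refine Real.lt_sqrt_of_sq_lt ?_
      rw [← sub_pos]
      have : G ^ 2 + 1 / G - ((1 - G) / (2 * G ^ 2) - G) ^ 2 =
          (4 * G ^ 3 * (2 - G) - (1 - G) ^ 2) / (4 * G ^ 4) := by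
        field_simp
        ring
      rw [this]
      have : 0 < 4 * G ^ 3 * (2 - G) - (1 - G) ^ 2 := by linarith
      positivity
    rw [hΔ0, hu0']
    have : 2 * G * ((1 - G) / (2 * G ^ 2)) < 2 * G * (G + Real.sqrt (G ^ 2 + 1 / G)) := by
      gcongr
      linarith
    have e1 : 2 * G * ((1 - G) / (2 * G ^ 2)) = 1 / G - 1 := by
      field_simp
    linarith
  have hev : ∀ᶠ c in 𝓝 (0 : ℝ), 0 < 1 - κ * c ∧ 0 < Δ c ∧ Δ c < 1 := by
    have hc : ContinuousAt Δ 0 := (hdΔ 0 (by simp)).continuousAt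
    refine Eventually.and ?_ ((hc.eventually_const_lt hscalene).and (hc.eventually_lt_const hnondeg))
    have : ContinuousAt (fun c : ℝ => 1 - κ * c) 0 := by fun_prop
    exact this.eventually_const_lt (by simp)
  obtain ⟨δ, hδ, hball⟩ := Metric.eventually_nhds_iff.1 hev
  have hin : ∀ c ∈ Set.Icc 0 (δ / 2), 0 < 1 - κ * c ∧ 0 < Δ c ∧ Δ c < 1 := fun c hc => by
    refine hball ?_
    rw [Real.dist_eq, sub_zero, abs_of_nonneg hc.1]
    linarith [hc.2]
  set α : ℝ → ℝ := fun c => (u c - Real.sqrt (Δ c)) / 2 with hα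
  set β : ℝ → ℝ := fun c => (u c + Real.sqrt (Δ c)) / 2 with hβ
  have hsum : ∀ c, α c + β c = u c := fun c => by simp only [hα, hβ]; ring
  have hprod : ∀ c ∈ Set.Icc 0 (δ / 2), α c * β c = e c * u c := fun c hc => by
    have := Real.sq_sqrt (hin c hc).2.1.le
    simp only [hα, hβ]
    have h' : Δ c = u c ^ 2 - 4 * e c * u c := rfl
    linear_combination -this / 4 - h' / 4
  have hepos : ∀ c ∈ Set.Icc 0 (δ / 2), 0 < e c := fun c hc => div_pos h0 (hin c hc).1
  have hupos : ∀ c ∈ Set.Icc 0 (δ / 2), 0 < u c := fun c hc => by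
    have := hepos c hc
    positivity
  have hlt : ∀ c ∈ Set.Icc 0 (δ / 2), α c < β c := fun c hc => by
    have := Real.sqrt_pos.2 (hin c hc).2.1
    simp only [hα, hβ]
    linarith
  have hβpos : ∀ c ∈ Set.Icc 0 (δ / 2), 0 < β c := fun c hc => by
    have := hupos c hc
    positivity
  have hαpos : ∀ c ∈ Set.Icc 0 (δ / 2), 0 < α c := fun c hc => by
    have hp : 0 < α c * β c := by
      rw [hprod c hc]
      exact mul_pos (hepos c hc) (hupos c hc)
    exact pos_of_mul_pos_left hp (hβpos c hc).le
  have hdα : ∀ c ∈ Set.Icc 0 (δ / 2), DifferentiableAt ℝ α c := fun c hc =>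
    ((hdu c (hin c hc).1).sub ((hdΔ c (hin c hc).1).sqrt (hin c hc).2.1.ne')).div_const 2
  have hdβ : ∀ c ∈ Set.Icc 0 (δ / 2), DifferentiableAt ℝ β c := fun c hc =>
    ((hdu c (hin c hc).1).add ((hdΔ c (hin c hc).1).sqrt (hin c hc).2.1.ne')).div_const 2
  -- Heron's formula
  have hheron : ∀ c ∈ Set.Icc 0 (δ / 2), 0 < α c ^ 2 - ((1 + α c ^ 2 - β c ^ 2) / 2) ^ 2 := by
    intro c hc
    have hdiff : (β c - α c) ^ 2 = Δ c := by
      rw [← Real.sq_sqrt (hin c hc).2.1.le]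
      simp only [hα, hβ]
      ring
    have : α c ^ 2 - ((1 + α c ^ 2 - β c ^ 2) / 2) ^ 2 = (u c ^ 2 - 1) * (1 - Δ c) / 4 := by
      rw [← hdiff, ← hsum]
      ring
    rw [this]
    have hu1 : 0 < u c ^ 2 - 1 := by
      have h2 : 1 < 1 / G := by rw [lt_div_iff₀ h0]; linarith
      have h3 := mul_pos (hepos c hc) (hupos c hc)
      linarith [hsq c]
    have := (hin c hc).2.2
    have : 0 < 1 - Δ c := by linarith
    positivity
  refine ⟨δ / 2, α, β, fun c => Real.sqrt (α c ^ 2 - ((1 + α c ^ 2 - β c ^ 2) / 2) ^ 2),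
    by positivity, hαpos, hlt, fun c hc => Real.sqrt_pos.2 (hheron c hc), fun c hc => ?_,
    fun c hc => ?_, fun c hc => Real.sq_sqrt (hheron c hc).le, hdα, hdβ, fun c hc => ?_⟩
  · have e1 := hsum c
    have e2 := hprod c hc
    have e3 := hsq c
    linear_combination (α c + β c + u c) * e1 - 2 * e2 + e3
  · have p1 := hαpos c hc
    have p2 := hβpos c hc
    have p3 := hupos c hc
    have p4 := hepos c hc
    have p5 := (hin c hc).1
    have e1 : G / α c + G / β c = G / e c := by
      have : G / α c + G / β c = G * (α c + β c) / (α c * β c) := by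
        field_simp
        ring
      rw [this, hprod c hc, hsum]
      field_simp
    have e2 : G / e c = 1 - κ * c := by
      simp only [he]
      field_simp
    linear_combination -e1 - e2
  · exact (((hdα c hc).pow 2).sub ((((((hdα c hc).pow 2).const_add 1).sub
      ((hdβ c hc).pow 2)).div_const 2).pow 2)).sqrt (hheron c hc).ne'

/-- The invariants determine the velocity along the shape curve: the derivatives with respect to
the size `c` satisfy the same linear system as the components of the vector field. -/
theorem IsShapeCurve.deriv_relations {G κ c₁ : ℝ} {α β y : ℝ → ℝ} (hs : IsShapeCurve G κ c₁ α β y)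
    {c : ℝ} (hc : c ∈ Set.Ioo 0 c₁) :
    α c * deriv α c + β c * deriv β c = 0 ∧
    G * (deriv α c / α c ^ 2 + deriv β c / β c ^ 2) = κ ∧
    y c * deriv y c = α c * deriv α c * (β c ^ 2 - α c ^ 2) := by
  have hc' : c ∈ Set.Icc 0 c₁ := Set.Ioo_subset_Icc_self hc
  have hnhds : Set.Icc 0 c₁ ∈ 𝓝 c := Icc_mem_nhds hc.1 hc.2
  have hα := (hs.diff_fst c hc').hasDerivAt
  have hβ := (hs.diff_snd c hc').hasDerivAt
  have hy := (hs.diff_height c hc').hasDerivAt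
  have pα := hs.pos c hc'
  have pβ := pα.trans (hs.lt c hc')
  have e1 : α c * deriv α c + β c * deriv β c = 0 := by
    have h1 : HasDerivAt (fun c => α c ^ 2 + β c ^ 2) 0 c :=
      (hasDerivAt_const c (1 / G)).congr_of_eventuallyEq
        (by filter_upwards [hnhds] with x hx using hs.moment x hx)
    have h2 := h1.unique ((hα.pow 2).add (hβ.pow 2))
    push_cast at h2
    linear_combination -h2 / 2
  refine ⟨e1, ?_, ?_⟩
  · have h1 : HasDerivAt (fun c => 1 - G / α c - G / β c) (κ * 1) c :=
      ((hasDerivAt_id c).const_mul κ).congr_of_eventuallyEq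
        (by filter_upwards [hnhds] with x hx using hs.energy x hx)
    have h2 := h1.unique ((((hasDerivAt_const c G).div hα pα.ne').const_sub 1).sub
      ((hasDerivAt_const c G).div hβ pβ.ne'))
    rw [mul_one] at h2
    rw [h2]
    ring
  · have h1 : HasDerivAt (fun c => y c ^ 2) _ c :=
      ((hα.pow 2).sub (((((hα.pow 2).const_add 1).sub (hβ.pow 2)).div_const 2).pow
        2)).congr_of_eventuallyEq
        (by filter_upwards [hnhds] with x hx using hs.height x hx)
    have h2 := h1.unique (hy.pow 2)
    simp at h2
    linear_combination -h2 / 2 + (1 + α c ^ 2 - β c ^ 2) / 2 * e1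

/-! ### Construction of collapsing solutions -/

/-- The configuration with relative positions `z 1 - z 0 = E` and `z 2 - z 0 = D` whose centre of
vorticity `z 0 - G * z 1 + z 2` is the origin. -/
noncomputable def centredConfiguration (G : ℝ) (E D : ℂ) : Fin 3 → ℂ :=
  ![(G * E - D) / (2 - G), (G * E - D) / (2 - G) + E, (G * E - D) / (2 - G) + D]

theorem r_centredConfiguration_zero_one (G : ℝ) (E D : ℂ) :
    r (centredConfiguration G E D) 0 1 = ‖E‖ := by
  simp [r_eq_norm, centredConfiguration]

theorem r_centredConfiguration_zero_two (G : ℝ) (E D : ℂ) :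
    r (centredConfiguration G E D) 0 2 = ‖D‖ := by
  simp [r_eq_norm, centredConfiguration]

theorem r_centredConfiguration_one_two (G : ℝ) (E D : ℂ) :
    r (centredConfiguration G E D) 1 2 = ‖E - D‖ := by
  simp [r_eq_norm, centredConfiguration]

/-- The equations of motion need to be checked for the relative positions only: the velocity of the
centre of vorticity vanishes. -/
theorem isSolution_centredConfiguration {G T : ℝ} (hG : G ≠ 2) {E D : ℝ → ℂ}
    (hE0 : ∀ t ∈ Set.Ico 0 T, E t ≠ 0) (hD0 : ∀ t ∈ Set.Ico 0 T, D t ≠ 0)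
    (hED : ∀ t ∈ Set.Ico 0 T, E t ≠ D t)
    (hE : ∀ t ∈ Set.Ico 0 T, HasDerivAt E (-(Complex.I / (2 * Real.pi)) *
      (((1 - G) / ‖E t‖ ^ 3 : ℝ) * E t + (1 / ‖E t - D t‖ ^ 3 : ℝ) * (E t - D t) +
        (1 / ‖D t‖ ^ 3 : ℝ) * D t)) t)
    (hD : ∀ t ∈ Set.Ico 0 T, HasDerivAt D (-(Complex.I / (2 * Real.pi)) *
      ((2 / ‖D t‖ ^ 3 : ℝ) * D t - (G / ‖E t - D t‖ ^ 3 : ℝ) * (D t - E t) -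
        (G / ‖E t‖ ^ 3 : ℝ) * E t)) t) :
    IsSolution (symmetricCirculation G) T fun t => centredConfiguration G (E t) (D t) := by
  have hG' : (2 - G : ℂ) ≠ 0 := by
    rw [sub_ne_zero]
    exact_mod_cast hG.symm
  refine ⟨fun t ht => ?_, fun t ht i => ?_⟩
  · have h1 := hE0 t ht
    have h2 := hD0 t ht
    have h3 := hED t ht
    have h4 := h3.symm
    clear hE0 hD0 hED hE hD
    intro i j hij
    fin_cases i <;> fin_cases j <;> simp_all [centredConfiguration]
  · refine HasDerivAt.hasDerivWithinAt ?_
    have h0 : HasDerivAt (fun t => ((G : ℂ) * E t - D t) / (2 - G)) _ t :=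
      (((hE t ht).const_mul (G : ℂ)).sub (hD t ht)).div_const (2 - G : ℂ)
    have e10 : r (centredConfiguration G (E t) (D t)) 1 0 = ‖E t‖ := by
      rw [r_symm, r_centredConfiguration_zero_one]
    have e20 : r (centredConfiguration G (E t) (D t)) 2 0 = ‖D t‖ := by
      rw [r_symm, r_centredConfiguration_zero_two]
    have e21 : r (centredConfiguration G (E t) (D t)) 2 1 = ‖E t - D t‖ := by
      rw [r_symm, r_centredConfiguration_one_two]
    rw [velocity_eq_sum]
    fin_cases i
    · refine h0.congr_deriv ?_
      simp only [Fin.zero_eta, sum_erase_zero, r_centredConfiguration_zero_one,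
        r_centredConfiguration_zero_two]
      simp [centredConfiguration, symmetricCirculation]
      field_simp
      ring
    · refine (h0.add (hE t ht)).congr_deriv ?_
      simp only [Fin.mk_one, sum_erase_one, e10, r_centredConfiguration_one_two]
      simp [centredConfiguration, symmetricCirculation]
      field_simp
      ring
    · refine (h0.add (hD t ht)).congr_deriv ?_
      simp only [Fin.reduceFinMk, sum_erase_two, e20, e21]
      simp [centredConfiguration, symmetricCirculation]
      field_simp
      ring

section Shape

variable {G κ c₁ : ℝ} {α β y : ℝ → ℝ}

/-- The apex of the triangle with base `[0, 1]` and sides `α c`, `β c`, in the upper half plane. -/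
noncomputable def shapePoint (α β y : ℝ → ℝ) (c : ℝ) : ℂ :=
  ((1 + α c ^ 2 - β c ^ 2) / 2 : ℝ) + (y c : ℝ) * Complex.I

/-- The rate of decrease of the size: `c ^ 2 c' = -Φ` with `Φ = shrinkRate G α β y c`. -/
noncomputable def shrinkRate (G : ℝ) (α β y : ℝ → ℝ) (c : ℝ) : ℝ :=
  G * y c * (1 / α c ^ 3 - 1 / β c ^ 3) / (2 * Real.pi)

theorem IsShapeCurve.norm_shapePoint (hs : IsShapeCurve G κ c₁ α β y) {c : ℝ}
    (hc : c ∈ Set.Icc 0 c₁) : ‖shapePoint α β y c‖ = α c := by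
  rw [shapePoint, Complex.norm_add_mul_I, hs.height c hc, add_sub_cancel,
    Real.sqrt_sq (hs.pos c hc).le]

theorem IsShapeCurve.norm_shapePoint_sub_one (hs : IsShapeCurve G κ c₁ α β y) {c : ℝ}
    (hc : c ∈ Set.Icc 0 c₁) : ‖shapePoint α β y c - 1‖ = β c := by
  have : shapePoint α β y c - 1 =
      ((1 + α c ^ 2 - β c ^ 2) / 2 - 1 : ℝ) + (y c : ℝ) * Complex.I := by
    rw [shapePoint]
    push_cast
    ring
  rw [this, Complex.norm_add_mul_I, hs.height c hc]
  refine Eq.trans ?_ (Real.sqrt_sq ((hs.pos c hc).trans (hs.lt c hc)).le)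
  congr 1
  ring

/-- The vector field for the shape `ζ = (z 1 - z 0) / (z 2 - z 0)` is tangent to the circle
`|ζ| ^ 2 + |ζ - 1| ^ 2 = 1 / G` of vanishing angular moment, and proportional there to `1 - 2 ζ`. -/
theorem IsShapeCurve.shape_field (hG : G ≠ 0) (hs : IsShapeCurve G κ c₁ α β y) {c : ℝ}
    (hc : c ∈ Set.Icc 0 c₁) :
    ((1 - G : ℂ) / α c ^ 3 * shapePoint α β y c + 1 / β c ^ 3 * (shapePoint α β y c - 1) + 1) -
      shapePoint α β y c * (2 - G / β c ^ 3 * (1 - shapePoint α β y c) -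
        G / α c ^ 3 * shapePoint α β y c) = κ * c * (1 - 2 * shapePoint α β y c) := by
  have hα := hs.pos c hc
  have hβ := hα.trans (hs.lt c hc)
  have hm : (G : ℝ) * (α c ^ 2 + β c ^ 2) = 1 := by
    rw [hs.moment c hc]
    field_simp
  have hsq : shapePoint α β y c ^ 2 =
      (1 + α c ^ 2 - β c ^ 2) * shapePoint α β y c - α c ^ 2 := by
    have hy : (y c : ℂ) ^ 2 = α c ^ 2 - ((1 + α c ^ 2 - β c ^ 2) / 2) ^ 2 := by
      exact_mod_cast hs.height c hc
    rw [shapePoint]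
    push_cast
    linear_combination -hy + (y c : ℂ) ^ 2 * Complex.I_sq
  have hm' : (G : ℂ) * (α c ^ 2 + β c ^ 2) = 1 := by exact_mod_cast hm
  have he : (1 : ℂ) - G / α c - G / β c = κ * c := by exact_mod_cast hs.energy c hc
  have hα' : (α c : ℂ) ≠ 0 := by exact_mod_cast hα.ne'
  have hβ' : (β c : ℂ) ≠ 0 := by exact_mod_cast hβ.ne'
  generalize shapePoint α β y c = ζ at hsq ⊢
  rw [← he]
  -- the coefficients of `ζ` and `1` after reducing `ζ ^ 2`
  have h1 : (1 - G : ℂ) / α c ^ 3 + 1 / β c ^ 3 - 2 + G / β c ^ 3 +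
      (1 + α c ^ 2 - β c ^ 2) * (G / α c ^ 3 - G / β c ^ 3) = -2 * (1 - G / α c - G / β c) := by
    field_simp
    linear_combination -(α c ^ 3 + β c ^ 3 : ℂ) * hm'
  have h2 : 1 - 1 / β c ^ 3 - (G / α c ^ 3 - G / β c ^ 3) * α c ^ 2 =
      (1 - G / α c - G / β c : ℂ) := by
    field_simp
    linear_combination (α c : ℂ) * hm'
  linear_combination (G / α c ^ 3 - G / β c ^ 3 : ℂ) * hsq + ζ * h1 + h2

/-- The direction and speed at which the shape moves along the curve as the size changes; combined
with `c ^ 2 c' = -Φ` this agrees with `IsShapeCurve.shape_field`. -/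
theorem IsShapeCurve.hasDerivAt_shapePoint (hs : IsShapeCurve G κ c₁ α β y) {c : ℝ}
    (hc : c ∈ Set.Ioo 0 c₁) :
    ∃ d : ℂ, HasDerivAt (shapePoint α β y) d c ∧
      d * shrinkRate G α β y c =
        Complex.I / (2 * Real.pi) * (κ * (1 - 2 * shapePoint α β y c)) := by
  have hc' : c ∈ Set.Icc 0 c₁ := Set.Ioo_subset_Icc_self hc
  obtain ⟨e1, e2, e3⟩ := hs.deriv_relations hc
  have hα := (hs.diff_fst c hc').hasDerivAt
  have hβ := (hs.diff_snd c hc').hasDerivAt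
  have hy := (hs.diff_height c hc').hasDerivAt
  have pα := hs.pos c hc'
  have pβ := pα.trans (hs.lt c hc')
  refine ⟨_, ((((hα.pow 2).const_add 1).sub (hβ.pow 2)).div_const 2).ofReal_comp.add
    (hy.ofReal_comp.mul_const Complex.I), ?_⟩
  -- `α α' G (1 / α ^ 3 - 1 / β ^ 3) = κ` determines the derivatives of both coordinates
  have h1 : α c * deriv α c * (G * (1 / α c ^ 3 - 1 / β c ^ 3)) = κ := by
    rw [← e2]
    field_simp
    linear_combination -α c ^ 2 * G * e1
  have h2 : (2 * α c ^ 1 * deriv α c - 2 * β c ^ 1 * deriv β c) / 2 *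
      (G * y c * (1 / α c ^ 3 - 1 / β c ^ 3)) = 2 * κ * y c := by
    linear_combination 2 * y c * h1 - G * y c * (1 / α c ^ 3 - 1 / β c ^ 3) * e1
  have h3 : deriv y c * (G * y c * (1 / α c ^ 3 - 1 / β c ^ 3)) = κ * (β c ^ 2 - α c ^ 2) := by
    linear_combination (β c ^ 2 - α c ^ 2) * h1 + (G * (1 / α c ^ 3 - 1 / β c ^ 3)) * e3
  have h2' := congrArg (fun x : ℝ => (x : ℂ)) h2
  have h3' := congrArg (fun x : ℝ => (x : ℂ)) h3
  rw [shrinkRate, shapePoint]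
  push_cast at h2' h3' ⊢
  linear_combination (1 / (2 * Real.pi) : ℂ) * h2' + (Complex.I / (2 * Real.pi) : ℂ) * h3' +
    κ * y c / Real.pi * Complex.I_sq

theorem IsShapeCurve.shrinkRate_pos (hG : 0 < G) (hs : IsShapeCurve G κ c₁ α β y) {c : ℝ}
    (hc : c ∈ Set.Icc 0 c₁) : 0 < shrinkRate G α β y c := by
  have hα := hs.pos c hc
  have hlt := hs.lt c hc
  have hy := hs.height_pos c hc
  have : 1 / β c ^ 3 < 1 / α c ^ 3 := by gcongr
  have := sub_pos.2 this
  rw [shrinkRate]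
  positivity

theorem IsShapeCurve.continuousOn_shrinkRate (hs : IsShapeCurve G κ c₁ α β y) :
    ContinuousOn (shrinkRate G α β y) (Set.Icc 0 c₁) := by
  have hα : ContinuousOn α (Set.Icc 0 c₁) := fun c hc =>
    (hs.diff_fst c hc).continuousAt.continuousWithinAt
  have hβ : ContinuousOn β (Set.Icc 0 c₁) := fun c hc =>
    (hs.diff_snd c hc).continuousAt.continuousWithinAt
  have hy : ContinuousOn y (Set.Icc 0 c₁) := fun c hc =>
    (hs.diff_height c hc).continuousAt.continuousWithinAt
  have hα0 : ∀ c ∈ Set.Icc 0 c₁, α c ^ 3 ≠ 0 := fun c hc => pow_ne_zero 3 (hs.pos c hc).ne'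
  have hβ0 : ∀ c ∈ Set.Icc 0 c₁, β c ^ 3 ≠ 0 := fun c hc =>
    pow_ne_zero 3 ((hs.pos c hc).trans (hs.lt c hc)).ne'
  exact ((continuousOn_const.mul hy).mul ((continuousOn_const.div (hα.pow 3) hα0).sub
    (continuousOn_const.div (hβ.pow 3) hβ0))).div_const _

/-- A shape curve carries a collapsing solution: the size follows from a quadrature, and the
orientation of the side `z 2 - z 0` from a further one. -/
theorem IsShapeCurve.exists_isCollapse (hG : 0 < G) (hG2 : G < 2) (hc₁ : 0 < c₁)
    (hs : IsShapeCurve G κ c₁ α β y) :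
    ∃ (T : ℝ) (z : ℝ → Fin 3 → ℂ), IsCollapse (symmetricCirculation G) T z ∧
      (∃ p : ℂ, ∀ i, Tendsto (fun t => z t i) (𝓝[<] T) (𝓝 p)) ∧
      ∀ t ∈ Set.Ico 0 T, hamiltonian (symmetricCirculation G) (z t) = κ / (2 * Real.pi) := by
  obtain ⟨ε, T, C, hε, hT, hC, hlim⟩ := exists_finite_time_shrinking hc₁
    hs.continuousOn_shrinkRate fun c hc => hs.shrinkRate_pos hG hc
  have hmem : ∀ t ∈ Set.Ico 0 T, t ∈ Set.Ioo (-ε) T := fun t ht => ⟨by linarith [ht.1], ht.2⟩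
  have hIcc : ∀ t ∈ Set.Ioo (-ε) T, C t ∈ Set.Icc 0 c₁ := fun t ht =>
    Set.Ioo_subset_Icc_self (hC t ht).1
  -- the real part of the relative angular velocity of the side `z 2 - z 0`
  set ρ : ℝ → ℝ := fun c => 2 - G / β c ^ 3 * (1 - (1 + α c ^ 2 - β c ^ 2) / 2) -
    G / α c ^ 3 * ((1 + α c ^ 2 - β c ^ 2) / 2) with hρ
  obtain ⟨φ, hφ⟩ : ∃ φ : ℝ → ℝ, ∀ t ∈ Set.Ioo (-ε) T,
      HasDerivAt φ (-ρ (C t) / (2 * Real.pi * C t ^ 3)) t := by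
    refine exists_antiderivative_Ioo fun t ht => ContinuousAt.continuousWithinAt ?_
    have hCt := (hC t ht).2.continuousAt
    have hα : ContinuousAt (fun t => α (C t)) t :=
      (hs.diff_fst _ (hIcc t ht)).continuousAt.comp (f := C) hCt
    have hβ : ContinuousAt (fun t => β (C t)) t :=
      (hs.diff_snd _ (hIcc t ht)).continuousAt.comp (f := C) hCt
    have h1 := (hC t ht).1.1.ne'
    have h2 := (hs.pos _ (hIcc t ht)).ne'
    have h3 := ((hs.pos _ (hIcc t ht)).trans (hs.lt _ (hIcc t ht))).ne'
    have hx : ContinuousAt (fun t => (1 + α (C t) ^ 2 - β (C t) ^ 2) / 2) t :=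
      ((continuousAt_const.add (hα.pow 2)).sub (hβ.pow 2)).div_const 2
    exact (((continuousAt_const.sub ((continuousAt_const.div (hβ.pow 3) (pow_ne_zero 3 h3)).mul
      (continuousAt_const.sub hx))).sub ((continuousAt_const.div (hα.pow 3)
        (pow_ne_zero 3 h2)).mul hx)).neg).div (continuousAt_const.mul (hCt.pow 3)) (by positivity)
  set ζ := shapePoint α β y
  set D : ℝ → ℂ := fun t => C t * Complex.exp (φ t * Complex.I) with hDdef
  set E : ℝ → ℂ := fun t => ζ (C t) * D t with hEdef
  have nD : ∀ t ∈ Set.Ioo (-ε) T, ‖D t‖ = C t := fun t ht => by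
    simp only [hDdef, norm_mul, Complex.norm_exp_ofReal_mul_I, mul_one, Complex.norm_real]
    exact abs_of_pos (hC t ht).1.1
  have nE : ∀ t ∈ Set.Ioo (-ε) T, ‖E t‖ = α (C t) * C t := fun t ht => by
    rw [hEdef, norm_mul, nD t ht, hs.norm_shapePoint (hIcc t ht)]
  have nED : ∀ t ∈ Set.Ioo (-ε) T, ‖E t - D t‖ = β (C t) * C t := fun t ht => by
    rw [show E t - D t = (ζ (C t) - 1) * D t by simp only [hEdef]; ring, norm_mul, nD t ht,
      hs.norm_shapePoint_sub_one (hIcc t ht)]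
  have pC : ∀ t ∈ Set.Ico 0 T, 0 < C t := fun t ht => (hC t (hmem t ht)).1.1
  have pα : ∀ t ∈ Set.Ico 0 T, 0 < α (C t) := fun t ht => hs.pos _ (hIcc t (hmem t ht))
  have pβ : ∀ t ∈ Set.Ico 0 T, 0 < β (C t) := fun t ht =>
    (pα t ht).trans (hs.lt _ (hIcc t (hmem t ht)))
  have hpi : (Real.pi : ℂ) ≠ 0 := by exact_mod_cast Real.pi_ne_zero
  have hD : ∀ t ∈ Set.Ico 0 T, HasDerivAt D (-(Complex.I / (2 * Real.pi)) *
      ((2 - G / β (C t) ^ 3 * (1 - ζ (C t)) - G / α (C t) ^ 3 * ζ (C t)) * D t / C t ^ 3)) t := by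
    intro t ht
    have hC0 : (C t : ℂ) ≠ 0 := by exact_mod_cast (pC t ht).ne'
    have hα0 : (α (C t) : ℂ) ≠ 0 := by exact_mod_cast (pα t ht).ne'
    have hβ0 : (β (C t) : ℂ) ≠ 0 := by exact_mod_cast (pβ t ht).ne'
    refine ((hC t (hmem t ht)).2.ofReal_comp.mul
      ((hφ t (hmem t ht)).ofReal_comp.mul_const Complex.I).cexp).congr_deriv ?_
    have hsplit : (2 - G / β (C t) ^ 3 * (1 - ζ (C t)) - G / α (C t) ^ 3 * ζ (C t) : ℂ) =
        ρ (C t) - Complex.I * (2 * Real.pi * shrinkRate G α β y (C t)) := by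
      simp only [hρ, shrinkRate, ζ, shapePoint]
      push_cast
      field_simp
      ring
    rw [hsplit]
    simp only [hDdef]
    push_cast
    field_simp
    linear_combination (-2 * Real.pi * shrinkRate G α β y (C t) : ℂ) * Complex.I_sq
  have hE : ∀ t ∈ Set.Ico 0 T, HasDerivAt E (-(Complex.I / (2 * Real.pi)) *
      (((1 - G) / α (C t) ^ 3 * ζ (C t) + 1 / β (C t) ^ 3 * (ζ (C t) - 1) + 1) *
        D t / C t ^ 3)) t := by
    intro t ht
    have hC0 : (C t : ℂ) ≠ 0 := by exact_mod_cast (pC t ht).ne'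
    obtain ⟨d, hd, hdΦ⟩ := hs.hasDerivAt_shapePoint (hC t (hmem t ht)).1
    have hζ := hd.scomp t (hC t (hmem t ht)).2
    refine (hζ.mul (hD t ht)).congr_deriv ?_
    have hfield := hs.shape_field hG.ne' (hIcc t (hmem t ht))
    rw [sub_eq_iff_eq_add] at hfield
    rw [hfield, Complex.real_smul, Function.comp_apply]
    push_cast
    rw [show (-(shrinkRate G α β y (C t) : ℂ) / C t ^ 2 * d) =
      -(d * shrinkRate G α β y (C t)) / C t ^ 2 by ring, hdΦ]
    field_simp
    ring
  have hsol : IsSolution (symmetricCirculation G) T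
      fun t => centredConfiguration G (E t) (D t) := by
    refine isSolution_centredConfiguration hG2.ne (fun t ht => ?_) (fun t ht => ?_)
      (fun t ht => ?_) (fun t ht => ?_) fun t ht => ?_
    · rw [← norm_pos_iff, nE t (hmem t ht)]
      exact mul_pos (pα t ht) (pC t ht)
    · rw [← norm_pos_iff, nD t (hmem t ht)]
      exact pC t ht
    · rw [← sub_ne_zero, ← norm_pos_iff, nED t (hmem t ht)]
      exact mul_pos (pβ t ht) (pC t ht)
    · refine (hE t ht).congr_deriv ?_
      rw [nE t (hmem t ht), nD t (hmem t ht), nED t (hmem t ht)]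
      simp only [hEdef]
      push_cast
      ring
    · refine (hD t ht).congr_deriv ?_
      rw [nE t (hmem t ht), nD t (hmem t ht), nED t (hmem t ht)]
      simp only [hEdef]
      push_cast
      ring
  have hev : ∀ᶠ t in 𝓝[<] T, t ∈ Set.Ioo (-ε) T := Ioo_mem_nhdsLT (by linarith)
  have limD : Tendsto D (𝓝[<] T) (𝓝 0) := by
    rw [tendsto_zero_iff_norm_tendsto_zero]
    exact hlim.congr' (hev.mono fun t ht => (nD t ht).symm)
  have limE : Tendsto E (𝓝[<] T) (𝓝 0) := by
    rw [tendsto_zero_iff_norm_tendsto_zero]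
    have h1 : Tendsto (fun t => α (C t) * C t) (𝓝[<] T) (𝓝 (α 0 * 0)) :=
      ((hs.diff_fst 0 ⟨le_rfl, hc₁.le⟩).continuousAt.tendsto.comp hlim).mul hlim
    rw [mul_zero] at h1
    exact h1.congr' (hev.mono fun t ht => (nE t ht).symm)
  have limz : ∀ i, Tendsto (fun t => centredConfiguration G (E t) (D t) i) (𝓝[<] T) (𝓝 0) := by
    have h0 : Tendsto (fun t => (G * E t - D t) / (2 - G)) (𝓝[<] T) (𝓝 0) := by
      simpa using ((limE.const_mul (G : ℂ)).sub limD).div_const (2 - G : ℂ)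
    intro i
    fin_cases i
    · exact h0
    · exact add_zero (0 : ℂ) ▸ h0.add limE
    · exact add_zero (0 : ℂ) ▸ h0.add limD
  refine ⟨T, fun t => centredConfiguration G (E t) (D t), ⟨hT, hsol, fun i j => ?_⟩,
    ⟨0, limz⟩, fun t ht => ?_⟩
  · simp only [r_eq_norm]
    simpa using ((limz i).sub (limz j)).norm
  · rw [hamiltonian_symmetricCirculation, r_centredConfiguration_zero_one,
      r_centredConfiguration_zero_two, r_centredConfiguration_one_two, nE t (hmem t ht),
      nD t (hmem t ht), nED t (hmem t ht)]
    have h1 := hs.energy _ (hIcc t (hmem t ht))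
    have h2 := pα t ht
    have h3 := pβ t ht
    have h4 := pC t ht
    field_simp at h1 ⊢
    linear_combination h1

end Shape

end SQGVortex

theorem proposition4 :
    -- the model possesses collapsing solutions
    (∃ (Γ : Fin 3 → ℝ) (T : ℝ) (z : ℝ → Fin 3 → ℂ), (∀ i, Γ i ≠ 0) ∧
      SQGVortex.IsCollapse Γ T z ∧ ∃ p : ℂ, ∀ i, Tendsto (fun t => z t i) (𝓝[<] T) (𝓝 p)) ∧
    -- symmetric case: a collapse is self-similar exactly when the Hamiltonian vanishes
    (∀ G : ℝ, 0 < G → ∀ (T : ℝ) (z : ℝ → Fin 3 → ℂ),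
      SQGVortex.IsCollapse (SQGVortex.symmetricCirculation G) T z →
        (SQGVortex.IsSelfSimilar T z ↔
          SQGVortex.hamiltonian (SQGVortex.symmetricCirculation G) (z 0) = 0)) ∧
    -- symmetric case: on the permitted interval, collapse occurs for every value of `H`
    (∃! Gs : ℝ, SQGVortex.IsCritical Gs) ∧
    (∀ Gs : ℝ, SQGVortex.IsCritical Gs → ∀ G : ℝ, Gs < G → G < 1 / 2 → ∀ h : ℝ,
      ∃ (T : ℝ) (z : ℝ → Fin 3 → ℂ),
        SQGVortex.IsCollapse (SQGVortex.symmetricCirculation G) T z ∧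
        (∃ p : ℂ, ∀ i, Tendsto (fun t => z t i) (𝓝[<] T) (𝓝 p)) ∧
        ∀ t ∈ Set.Ico 0 T,
          SQGVortex.hamiltonian (SQGVortex.symmetricCirculation G) (z t) = h) := by
  have main : ∀ Gs : ℝ, SQGVortex.IsCritical Gs → ∀ G : ℝ, Gs < G → G < 1 / 2 → ∀ h : ℝ,
      ∃ (T : ℝ) (z : ℝ → Fin 3 → ℂ),
        SQGVortex.IsCollapse (SQGVortex.symmetricCirculation G) T z ∧
        (∃ p : ℂ, ∀ i, Tendsto (fun t => z t i) (𝓝[<] T) (𝓝 p)) ∧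
        ∀ t ∈ Set.Ico 0 T,
          SQGVortex.hamiltonian (SQGVortex.symmetricCirculation G) (z t) = h := by
    intro Gs hGs G hlt hG h
    have h0 : 0 < G := hGs.1.trans hlt
    obtain ⟨c₁, α, β, y, hc₁, hs⟩ := SQGVortex.exists_isShapeCurve h0 hG
      (SQGVortex.quartic_lt_of_lt hGs.1 hlt (by linarith) hGs.quartic.ge) (2 * Real.pi * h)
    have := hs.exists_isCollapse h0 (by linarith) hc₁
    rwa [mul_div_cancel_left₀ h (by positivity)] at this
  refine ⟨?_, fun G hG T z hz => ⟨hz.hamiltonian_eq_zero_of_isSelfSimilar,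
    hz.isSelfSimilar_of_hamiltonian_eq_zero hG⟩, SQGVortex.existsUnique_isCritical, main⟩
  obtain ⟨Gs, hGs, -⟩ := SQGVortex.existsUnique_isCritical
  obtain ⟨G, hlt, hG⟩ := exists_between hGs.2.1
  obtain ⟨T, z, hz, hp, -⟩ := main Gs hGs G hlt hG 0
  refine ⟨_, T, z, fun i => ?_, hz, hp⟩
  have h0 : G ≠ 0 := (hGs.1.trans hlt).ne'
  fin_cases i <;> simp [SQGVortex.symmetricCirculation, h0]
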